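/- **Adiabatic theorem.** Let $\mathcal H$ be a complex Hilbert space and $T\ge 0$. For $t\in[0,T]$ let $H_0(t)$ be a bounded self-adjoint operator on $\mathcal H$ with the finite spectral representation $$H_0(t)=\sum_{\ell=1}^m E_\ell(t)P_\ell(t),$$ where $E_\ell(t)\in\mathbb R$, $P_\ell(t)=P_\ell(t)^\dagger$, $P_k(t)P_\ell(t)=\delta_{k\ell}P_\ell(t)$ for all $k,\ell$, and $\sum_{\ell=1}^m P_\ell(t)=1$. Assume that every $E_\ell$ is $C^1$ and every $P_\ell$ is $C^2$ (in operator norm) on $[0,T]$, and that there are no level crossings: $|E_k(t)-E_\ell(t)|>0$ for all $t\in[0,T]$ and $k\neq\ell$. Put $$A(t)=\sum_{\ell=1}^m\frac{\mathrm i}{2}[\dot P_\ell(t),P_\ell(t)],\qquad \eta=\min_{k\neq\ell}\min_{t\in[0,T]}|E_k(t)-E_\ell(t)|,\qquad \eta'=\max_{k\neq\ell}\max_{t\in[0,T]}|\dot E_k(t)-\dot E_\ell(t)|,$$ and $\|B\|_{\infty,T}=\sup_{s\in[0,T]}\|B(s)\|$, with $\|\cdot\|$ the operator norm. For a norm-continuous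 family $H(t)$ of bounded operators let $$\mathcal T\exp\Bigl(-\mathrm i\int_0^t H(s)\,ds\Bigr)=\sum_{n\ge0}(-\mathrm i)^n\int_{t\ge s_1\ge\dots\ge s_n\ge0}H(s_1)\cdots H(s_n)\,ds_1\cdots ds_n$$ be the propagator it generates. Then, for all $\kappa>0$ and all $t\in[0,T]$, $$\left\|\mathcal T\exp\Bigl(-\mathrm i\int_0^t\kappa H_0(s)\,ds\Bigr)-\mathcal T\exp\Bigl(-\mathrm i\int_0^t[\kappa H_0(s)+A(s)]\,ds\Bigr)\right\|\le\frac{\sqrt m}{\kappa\eta}\,(1+T\|A\|_{\infty,T})\left[\Bigl(2+\frac{\eta'}{\eta}T\Bigr)\|A\|_{\infty,T}+T\|\dot A\|_{\infty,T}\right].$$ (If $m\le 1$ there is no gap, $A=0$, and the right-hand side is read as $0$.) -/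

import Mathlib

open Set

noncomputable section

namespace Adiabatic

variable {𝓗 : Type*} [NormedAddCommGroup 𝓗] [InnerProductSpace ℂ 𝓗] [CompleteSpace 𝓗]

/-- The `n`-th term of the Dyson series of the time-dependent Hamiltonian `H`, i.e.
`(-i)^n ∫_{t ≥ s₁ ≥ ⋯ ≥ sₙ ≥ 0} H(s₁) ⋯ H(sₙ)`, written as an iterated integral. -/
def dysonTerm (H : ℝ → 𝓗 →L[ℂ] 𝓗) : ℕ → ℝ → 𝓗 →L[ℂ] 𝓗
  | 0 => fun _ => 1
  | n + 1 => fun t => (-Complex.I) • ∫ s in (0 : ℝ)..t, H s * dysonTerm H n s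

/-- The propagator `𝒯 exp(-i ∫₀ᵗ H(s) ds)` generated by `H`, as the sum of the Dyson series
(which converges in operator norm when `H` is integrable on `[0, t]`). -/
def propagator (H : ℝ → 𝓗 →L[ℂ] 𝓗) (t : ℝ) : 𝓗 →L[ℂ] 𝓗 :=
  ∑' n, dysonTerm H n t

/-- `‖A‖_{∞,T} = sup_{s ∈ [0,T]} ‖A(s)‖`. -/
def supNorm (T : ℝ) (A : ℝ → 𝓗 →L[ℂ] 𝓗) : ℝ :=
  sSup ((fun s => ‖A s‖) '' Icc 0 T)

/-- The generator `A(t) = ∑ₗ (i/2) [Ṗₗ(t), Pₗ(t)]` of the adiabatic transporter; the time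
derivatives are taken within `[0, T]` (one-sided at the end points). -/
def connection {m : ℕ} (T : ℝ) (P : Fin m → ℝ → 𝓗 →L[ℂ] 𝓗) (t : ℝ) : 𝓗 →L[ℂ] 𝓗 :=
  ∑ l, (Complex.I / 2) •
    (derivWithin (P l) (Icc 0 T) t * P l t - P l t * derivWithin (P l) (Icc 0 T) t)

/-- The minimal spectral gap `η = min_{k ≠ l} min_{t ∈ [0,T]} |Eₖ(t) - Eₗ(t)|`. -/
def minGap {m : ℕ} (T : ℝ) (E : Fin m → ℝ → ℝ) : ℝ :=
  sInf {x | ∃ k l : Fin m, k ≠ l ∧ ∃ t ∈ Icc 0 T, x = |E k t - E l t|}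

/-- The maximal spectral slope `η' = max_{k ≠ l} max_{t ∈ [0,T]} |d/dt (Eₖ(t) - Eₗ(t))|`. -/
def maxSlope {m : ℕ} (T : ℝ) (E : Fin m → ℝ → ℝ) : ℝ :=
  sSup {x | ∃ k l : Fin m, k ≠ l ∧ ∃ t ∈ Icc 0 T,
    x = |derivWithin (fun s => E k s - E l s) (Icc 0 T) t|}

end Adiabatic

end

open Set

noncomputable section

namespace Adiabatic

variable {𝓗 : Type*} [NormedAddCommGroup 𝓗] [InnerProductSpace ℂ 𝓗] {T : ℝ}

/-! Let `U` and `V` be the propagators of `κ H₀` and `κ H₀ + A`. Then `V†U` has derivative `i V†AU`,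
which is not small but oscillates at rate `κ`. Since `A` has no diagonal blocks
(`proj_mul_connection_mul_proj`), `F = ∑ (E k - E l)⁻¹ P k A P l` solves `[H₀, F] = A`
(`commutator_sum_blocks`). Subtracting `κ⁻¹ V†FU` from `V†U` therefore cancels `i V†AU` and leaves a
derivative of order `κ⁻¹`; this is integration by parts in differential form
(`norm_propagator_sub_le`).

The remainder contains `F' + i[A, F]`. The projections are parallel, `P' = -i[A, P]`
(`derivWithin_proj`), so this covariant derivative differentiates only the weights and `A`
(`hasDerivWithinAt_sum_blocks`). Block sums are bounded by `norm_sum_blocks_le`, the source of `√m`;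
the weights cost `1/η` and their derivatives `η'/η²`. -/

theorem hasDerivWithinAt_integral_Icc {F : Type*} [NormedAddCommGroup F] [NormedSpace ℝ F]
    [CompleteSpace F] {T : ℝ} {f : ℝ → F} (hf : ContinuousOn f (Icc 0 T)) {t : ℝ}
    (ht : t ∈ Icc 0 T) :
    HasDerivWithinAt (fun u => ∫ s in (0 : ℝ)..u, f s) (f t) (Icc 0 T) t := by
  have : Fact (t ∈ Icc 0 T) := ⟨ht⟩
  refine intervalIntegral.integral_hasDerivWithinAt_right (s := Icc 0 T) (t := Icc 0 T) ?_ ?_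
    (hf t ht)
  · refine (hf.mono ?_).intervalIntegrable
    rw [uIcc_of_le ht.1]
    exact Icc_subset_Icc le_rfl ht.2
  · exact hf.stronglyMeasurableAtFilter_nhdsWithin measurableSet_Icc t

theorem norm_one_le : ‖(1 : 𝓗 →L[ℂ] 𝓗)‖ ≤ 1 := ContinuousLinearMap.norm_id_le

theorem propagator_zero (H : ℝ → 𝓗 →L[ℂ] 𝓗) : propagator H 0 = 1 := by
  rw [propagator, tsum_eq_single 0]
  · rfl
  · intro n hn
    obtain ⟨k, rfl⟩ := Nat.exists_eq_succ_of_ne_zero hn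
    simp [dysonTerm]

theorem le_supNorm {A : ℝ → 𝓗 →L[ℂ] 𝓗} (hA : ContinuousOn A (Icc 0 T)) {t : ℝ}
    (ht : t ∈ Icc 0 T) : ‖A t‖ ≤ supNorm T A :=
  le_csSup (isCompact_Icc.image_of_continuousOn hA.norm).bddAbove ⟨t, ht, rfl⟩

theorem supNorm_nonneg (A : ℝ → 𝓗 →L[ℂ] 𝓗) : 0 ≤ supNorm T A := by
  refine Real.sSup_nonneg ?_
  rintro _ ⟨t, -, rfl⟩
  exact norm_nonneg _

theorem sum_derivWithin_proj {m : ℕ} {P : Fin m → ℝ → 𝓗 →L[ℂ] 𝓗} (hT : 0 < T)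
    (hP : ∀ l, DifferentiableOn ℝ (P l) (Icc 0 T)) (hPsum : ∀ t ∈ Icc 0 T, ∑ l, P l t = 1)
    {t : ℝ} (ht : t ∈ Icc 0 T) :
    ∑ l, derivWithin (P l) (Icc 0 T) t = 0 := by
  have hu := uniqueDiffOn_Icc hT t ht
  have h := (HasDerivWithinAt.fun_sum (u := Finset.univ) fun l _ =>
    (hP l t ht).hasDerivWithinAt).derivWithin hu
  refine h.symm.trans ?_
  rw [derivWithin_congr (f := fun _ => 1) (fun s hs => hPsum s hs) (hPsum t ht)]
  simp

/-! ### Algebra of a resolution of the identity and its derivative. -/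

section Algebra

variable {ι : Type*} [Fintype ι] [DecidableEq ι] {p d : ι → 𝓗 →L[ℂ] 𝓗}

/-- The off-diagonal part of `a` is the commutator of `∑ e k • p k` with the solution of the
Sylvester equation. -/
theorem commutator_sum_blocks (hmul : ∀ k l, p k * p l = if k = l then p l else 0)
    (hsum : ∑ l, p l = 1) {e : ι → ℝ} (he : ∀ k l, k ≠ l → e k ≠ e l) {a : 𝓗 →L[ℂ] 𝓗}
    (hdiag : ∀ k, p k * a * p k = 0) :
    (∑ k, e k • p k) * (∑ k, ∑ l, (e k - e l)⁻¹ • (p k * a * p l)) -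
      (∑ k, ∑ l, (e k - e l)⁻¹ • (p k * a * p l)) * (∑ k, e k • p k) = a := by
  have hl : ∀ k, (∑ j, e j • p j) * p k = e k • p k := by
    intro k
    simp [Finset.sum_mul, hmul]
  have hr : ∀ k, p k * (∑ j, e j • p j) = e k • p k := by
    intro k
    simp [Finset.mul_sum, hmul]
  have ha : a = ∑ k, ∑ l, p k * a * p l := by
    calc a = (∑ k, p k) * a * (∑ l, p l) := by simp [hsum]
      _ = _ := by
        rw [Finset.sum_mul, Finset.sum_mul]
        simp only [Finset.mul_sum]
  conv_rhs => rw [ha]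
  rw [Finset.mul_sum, Finset.sum_mul, ← Finset.sum_sub_distrib]
  refine Finset.sum_congr rfl fun k _ => ?_
  rw [Finset.mul_sum, Finset.sum_mul, ← Finset.sum_sub_distrib]
  refine Finset.sum_congr rfl fun l _ => ?_
  rw [mul_smul_comm, smul_mul_assoc, mul_assoc _ (p l), hr, ← mul_assoc, ← mul_assoc, hl,
    mul_smul_comm, smul_mul_assoc, smul_mul_assoc, ← smul_sub, ← sub_smul, smul_smul]
  -- No weight can reproduce a diagonal block, since its commutator factor is zero; `hdiag` makes
  -- that block vanish.
  rcases eq_or_ne k l with rfl | hkl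
  · simp [hdiag]
  · rw [inv_mul_cancel₀ (sub_ne_zero.2 (he k l hkl)), one_smul]

/-- The Leibniz rule for `p l * p l = p l` turns each commutator into `2 d p - d`, and the `d l` sum
to zero. -/
theorem sum_commutator_eq
    (hleib : ∀ k l, d k * p l + p k * d l = if k = l then d l else 0) (hd : ∑ l, d l = 0) :
    ∑ l, (Complex.I / 2) • (d l * p l - p l * d l) = Complex.I • ∑ l, d l * p l := by
  have h : ∀ l, (Complex.I / 2) • (d l * p l - p l * d l) =
      Complex.I • (d l * p l) - (Complex.I / 2) • d l := by
    intro l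
    have h1 : p l * d l = d l - d l * p l := by
      rw [eq_sub_iff_add_eq, add_comm]
      simpa using hleib l l
    rw [h1]
    module
  rw [Finset.sum_congr rfl fun l _ => h l, Finset.sum_sub_distrib, ← Finset.smul_sum,
    ← Finset.smul_sum, hd, smul_zero, sub_zero]

theorem sum_mul_proj (hmul : ∀ k l, p k * p l = if k = l then p l else 0) (l : ι) :
    (∑ k, d k * p k) * p l = d l * p l := by
  simp [Finset.sum_mul, mul_assoc, hmul]

theorem proj_mul_sum (hmul : ∀ k l, p k * p l = if k = l then p l else 0)
    (hsum : ∑ l, p l = 1)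
    (hleib : ∀ k l, d k * p l + p k * d l = if k = l then d l else 0) (l : ι) :
    p l * (∑ k, d k * p k) = d l * p l - d l := by
  have h : ∀ k, p l * (d k * p k) = (if l = k then d k * p k else 0) - d l * p k := by
    intro k
    have h1 : p l * d k = (if l = k then d k else 0) - d l * p k := by
      rw [eq_sub_iff_add_eq, add_comm, hleib]
    rw [← mul_assoc, h1, sub_mul, mul_assoc, hmul k k]
    simp
  rw [Finset.mul_sum, Finset.sum_congr rfl fun k _ => h k, Finset.sum_sub_distrib,
    ← Finset.mul_sum, hsum]
  simp

end Algebra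

/-! ### Dyson series: convergence, Schrödinger equation, unitarity. -/

variable [CompleteSpace 𝓗]

theorem continuousOn_dysonTerm {T : ℝ} {H : ℝ → 𝓗 →L[ℂ] 𝓗} (hH : ContinuousOn H (Icc 0 T))
    (n : ℕ) : ContinuousOn (dysonTerm H n) (Icc 0 T) := by
  induction n with
  | zero => exact continuousOn_const
  | succ n ih =>
    exact ContinuousOn.const_smul (fun t ht =>
      (hasDerivWithinAt_integral_Icc (hH.mul ih) ht).continuousWithinAt) (-Complex.I)

theorem norm_dysonTerm_le {T M : ℝ} {H : ℝ → 𝓗 →L[ℂ] 𝓗} (hM : ∀ s ∈ Icc 0 T, ‖H s‖ ≤ M)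
    (n : ℕ) : ∀ t ∈ Icc 0 T, ‖dysonTerm H n t‖ ≤ (M * t) ^ n / n.factorial := by
  induction n with
  | zero => intro t _; simpa [dysonTerm] using norm_one_le
  | succ n ih =>
    intro t ht
    have hbound : ∀ s ∈ Ioc 0 t, ‖H s * dysonTerm H n s‖ ≤ M ^ (n + 1) / n.factorial * s ^ n := by
      intro s hs
      have hs' : s ∈ Icc 0 T := ⟨hs.1.le, hs.2.trans ht.2⟩
      calc ‖H s * dysonTerm H n s‖ ≤ ‖H s‖ * ‖dysonTerm H n s‖ := norm_mul_le _ _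
        _ ≤ M * ((M * s) ^ n / n.factorial) :=
          mul_le_mul (hM s hs') (ih s hs') (norm_nonneg _) ((norm_nonneg _).trans (hM s hs'))
        _ = M ^ (n + 1) / n.factorial * s ^ n := by ring
    have hint := intervalIntegral.norm_integral_le_of_norm_le (μ := MeasureTheory.volume) ht.1
      (Filter.Eventually.of_forall hbound)
      ((continuous_const.mul (continuous_pow n)).intervalIntegrable _ _)
    rw [dysonTerm, norm_smul, norm_neg, Complex.norm_I, one_mul]
    refine hint.trans (le_of_eq ?_)
    rw [intervalIntegral.integral_const_mul, integral_pow, Nat.factorial_succ]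
    push_cast
    field_simp
    simp [mul_pow]

section Continuous

variable {H : ℝ → 𝓗 →L[ℂ] 𝓗}

theorem exists_norm_dysonTerm_le (hH : ContinuousOn H (Icc 0 T)) :
    ∃ u : ℕ → ℝ, Summable u ∧ ∀ n, ∀ t ∈ Icc 0 T, ‖dysonTerm H n t‖ ≤ u n := by
  obtain ⟨M, hM⟩ := isCompact_Icc.exists_bound_of_continuousOn hH
  refine ⟨_, Real.summable_pow_div_factorial (M * T), fun n t ht => ?_⟩
  have hM0 : 0 ≤ M := (norm_nonneg _).trans (hM t ht)
  have := ht.1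
  refine (norm_dysonTerm_le hM n t ht).trans ?_
  gcongr
  exact ht.2

theorem continuousOn_propagator (hH : ContinuousOn H (Icc 0 T)) :
    ContinuousOn (propagator H) (Icc 0 T) := by
  obtain ⟨u, hu, hb⟩ := exists_norm_dysonTerm_le hH
  exact continuousOn_tsum (continuousOn_dysonTerm hH) hu hb

theorem propagator_eq_integral (hH : ContinuousOn H (Icc 0 T)) {t : ℝ} (ht : t ∈ Icc 0 T) :
    propagator H t = 1 + (-Complex.I) • ∫ s in (0 : ℝ)..t, H s * propagator H s := by
  obtain ⟨u, hu, hb⟩ := exists_norm_dysonTerm_le hH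
  obtain ⟨M, hM⟩ := isCompact_Icc.exists_bound_of_continuousOn hH
  have hsub : uIoc 0 t ⊆ Icc 0 T := by
    rw [uIoc_of_le ht.1]
    exact fun s hs => ⟨hs.1.le, hs.2.trans ht.2⟩
  have hsummable : ∀ s ∈ Icc 0 T, Summable fun n => dysonTerm H n s := fun s hs =>
    Summable.of_norm_bounded hu fun n => hb n s hs
  have hsum : HasSum (fun n => ∫ s in (0 : ℝ)..t, H s * dysonTerm H n s)
      (∫ s in (0 : ℝ)..t, H s * propagator H s) := by
    refine intervalIntegral.hasSum_integral_of_dominated_convergence (fun n _ => M * u n)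
      (fun n => ?_) (fun n => .of_forall fun s hs => ?_) (.of_forall fun s _ => hu.mul_left M)
      intervalIntegrable_const (.of_forall fun s hs => ?_)
    · exact ((hH.mul (continuousOn_dysonTerm hH n)).mono hsub).aestronglyMeasurable
        measurableSet_uIoc
    · exact (norm_mul_le _ _).trans (mul_le_mul (hM s (hsub hs)) (hb n s (hsub hs))
        (norm_nonneg _) ((norm_nonneg _).trans (hM s (hsub hs))))
    · exact (hsummable s (hsub hs)).hasSum.mul_left (H s)
  rw [propagator, (hsummable t ht).tsum_eq_zero_add]
  congr 1
  exact (hsum.const_smul (-Complex.I)).tsum_eq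

/-- The propagator solves the Schrödinger equation `U̇ = -i H U`. -/
theorem hasDerivWithinAt_propagator (hH : ContinuousOn H (Icc 0 T)) {t : ℝ} (ht : t ∈ Icc 0 T) :
    HasDerivWithinAt (propagator H) ((-Complex.I) • (H t * propagator H t)) (Icc 0 T) t := by
  refine HasDerivWithinAt.congr (f := fun u =>
    1 + (-Complex.I) • ∫ s in (0 : ℝ)..u, H s * propagator H s) ?_
    (fun s hs => propagator_eq_integral hH hs) (propagator_eq_integral hH ht)
  exact ((hasDerivWithinAt_integral_Icc
    (hH.mul (continuousOn_propagator hH)) ht).const_smul (-Complex.I)).const_add 1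

theorem hasDerivWithinAt_star_propagator (hH : ContinuousOn H (Icc 0 T))
    (hsa : ∀ t ∈ Icc 0 T, IsSelfAdjoint (H t)) {t : ℝ} (ht : t ∈ Icc 0 T) :
    HasDerivWithinAt (fun s => star (propagator H s))
      (Complex.I • (star (propagator H t) * H t)) (Icc 0 T) t := by
  refine (hasDerivWithinAt_propagator hH ht).star.congr_deriv ?_
  rw [star_smul, star_mul, (hsa t ht).star_eq]
  simp

theorem star_propagator_mul_self (hH : ContinuousOn H (Icc 0 T))
    (hsa : ∀ t ∈ Icc 0 T, IsSelfAdjoint (H t)) {t : ℝ} (ht : t ∈ Icc 0 T) :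
    star (propagator H t) * propagator H t = 1 := by
  have hd : ∀ s ∈ Icc 0 T, HasDerivWithinAt (fun s => star (propagator H s) * propagator H s)
      0 (Icc 0 T) s := by
    intro s hs
    refine ((hasDerivWithinAt_star_propagator hH hsa hs).mul
      (hasDerivWithinAt_propagator hH hs)).congr_deriv ?_
    simp [mul_assoc]
  have h := (convex_Icc 0 T).norm_image_sub_le_of_norm_hasDerivWithin_le hd
    (C := 0) (by simp) (left_mem_Icc.2 (ht.1.trans ht.2)) ht
  simpa [propagator_zero, sub_eq_zero] using h

/-- In infinite dimension an isometry need not be unitary, so this needs its own argument: the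
defect `Z` solves a homogeneous linear equation with `Z 0 = 0`, and Grönwall forces `Z = 0`. -/
theorem propagator_mul_star_self (hH : ContinuousOn H (Icc 0 T))
    (hsa : ∀ t ∈ Icc 0 T, IsSelfAdjoint (H t)) {t : ℝ} (ht : t ∈ Icc 0 T) :
    propagator H t * star (propagator H t) = 1 := by
  obtain ⟨M, hM⟩ := isCompact_Icc.exists_bound_of_continuousOn hH
  set Z : ℝ → 𝓗 →L[ℂ] 𝓗 := fun s => propagator H s * star (propagator H s) - 1 with hZ
  have hd : ∀ s ∈ Icc 0 T, HasDerivWithinAt Z (Complex.I • (Z s * H s - H s * Z s))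
      (Icc 0 T) s := by
    intro s hs
    refine (((hasDerivWithinAt_propagator hH hs).mul
      (hasDerivWithinAt_star_propagator hH hsa hs)).sub_const 1).congr_deriv ?_
    simp only [hZ, smul_mul_assoc, mul_smul_comm, neg_smul, neg_mul, smul_sub, sub_mul, mul_sub,
      one_mul, mul_one, mul_assoc]
    abel
  have h := norm_le_gronwallBound_of_norm_deriv_right_le (δ := 0) (K := 2 * M) (ε := 0)
    (fun s hs => (hd s hs).continuousWithinAt)
    (fun s hs => (hd s ⟨hs.1, hs.2.le⟩).mono_of_mem_nhdsWithin
      (Filter.mem_of_superset (Icc_mem_nhdsGE hs.2) (Icc_subset_Icc hs.1 le_rfl)))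
    (by simp [hZ, propagator_zero]) (fun s hs => ?_) t ht
  · rw [gronwallBound_ε0_δ0] at h
    simpa [hZ, sub_eq_zero] using h
  · have hMs := hM s ⟨hs.1, hs.2.le⟩
    rw [norm_smul, Complex.norm_I, one_mul, add_zero]
    refine (norm_sub_le _ _).trans ((add_le_add (norm_mul_le _ _) (norm_mul_le _ _)).trans ?_)
    nlinarith [norm_nonneg (Z s)]

theorem norm_propagator_le_one (hH : ContinuousOn H (Icc 0 T))
    (hsa : ∀ t ∈ Icc 0 T, IsSelfAdjoint (H t)) {t : ℝ} (ht : t ∈ Icc 0 T) :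
    ‖propagator H t‖ ≤ 1 := by
  have h := CStarRing.norm_star_mul_self (x := propagator H t)
  rw [star_propagator_mul_self hH hsa ht] at h
  nlinarith [norm_one_le (𝓗 := 𝓗), norm_nonneg (propagator H t)]

end Continuous

/-! ### Norm bounds from orthogonality of the blocks. -/

section Resolution

variable {ι : Type*} [Fintype ι] [DecidableEq ι] {p : ι → 𝓗 →L[ℂ] 𝓗}

theorem sum_norm_sq_apply (hadj : ∀ l, IsSelfAdjoint (p l))
    (hmul : ∀ k l, p k * p l = if k = l then p l else 0) (hsum : ∑ l, p l = 1) (x : 𝓗) :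
    ∑ l, ‖p l x‖ ^ 2 = ‖x‖ ^ 2 := by
  have h : ∀ l, ((‖p l x‖ ^ 2 : ℝ) : ℂ) = inner ℂ x (p l x) := by
    intro l
    have h1 : p l (p l x) = p l x := by
      have := hmul l l
      rw [if_pos rfl] at this
      exact congrArg (fun a : 𝓗 →L[ℂ] 𝓗 => a x) this
    have h2 := ContinuousLinearMap.adjoint_inner_right (p l) x (p l x)
    rw [← ContinuousLinearMap.star_eq_adjoint, (hadj l).star_eq, h1] at h2
    rw [h2, inner_self_eq_norm_sq_to_K]
    simp
  have hx : ∑ l, p l x = x := by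
    have := congrArg (fun a : 𝓗 →L[ℂ] 𝓗 => a x) hsum
    simpa using this
  apply Complex.ofReal_injective
  rw [Complex.ofReal_sum, Finset.sum_congr rfl fun l _ => h l, ← inner_sum, hx,
    inner_self_eq_norm_sq_to_K]
  simp

theorem norm_sum_smul_apply_le (hadj : ∀ l, IsSelfAdjoint (p l))
    (hmul : ∀ k l, p k * p l = if k = l then p l else 0) (hsum : ∑ l, p l = 1)
    {c : ι → ℝ} {b : ℝ} (hb : 0 ≤ b) (hc : ∀ k, |c k| ≤ b) (y : 𝓗) :
    ‖∑ k, c k • p k y‖ ≤ b * ‖y‖ := by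
  have happ : ∀ j, p j (∑ k, c k • p k y) = c j • p j y := by
    intro j
    have hjk : ∀ k, p j (c k • p k y) = if j = k then c k • p k y else 0 := by
      intro k
      have h : c k • p j (p k y) = c k • (if j = k then p k else 0) y :=
        congrArg (fun a : 𝓗 →L[ℂ] 𝓗 => c k • a y) (hmul j k)
      rw [ContinuousLinearMap.map_smul_of_tower, h]
      split_ifs <;> simp
    rw [map_sum, Finset.sum_congr rfl fun k _ => hjk k]
    simp
  refine abs_le_of_sq_le_sq' ?_ (by positivity) |>.2
  rw [← sum_norm_sq_apply hadj hmul hsum, mul_pow, ← sum_norm_sq_apply hadj hmul hsum y,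
    Finset.mul_sum]
  refine Finset.sum_le_sum fun j _ => ?_
  rw [happ, norm_smul, mul_pow, Real.norm_eq_abs]
  gcongr
  exact hc j

/-- Weighting the blocks of `a` by numbers of modulus at most `b` increases the norm by at most the
factor `√m b`, where `m` is the number of blocks. -/
theorem norm_sum_blocks_le (hadj : ∀ l, IsSelfAdjoint (p l))
    (hmul : ∀ k l, p k * p l = if k = l then p l else 0) (hsum : ∑ l, p l = 1)
    {c : ι → ι → ℝ} {b : ℝ} (hb : 0 ≤ b) (hc : ∀ k l, |c k l| ≤ b) (a : 𝓗 →L[ℂ] 𝓗) :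
    ‖∑ k, ∑ l, c k l • (p k * a * p l)‖ ≤ √(Fintype.card ι) * b * ‖a‖ := by
  refine ContinuousLinearMap.opNorm_le_bound _ (by positivity) fun x => ?_
  have hx : (∑ k, ∑ l, c k l • (p k * a * p l)) x = ∑ l, ∑ k, c k l • p k (a (p l x)) := by
    rw [Finset.sum_comm]
    simp
  -- Rows are handled by orthogonality without loss; columns only by the triangle inequality, and
  -- Cauchy–Schwarz over them costs `√m`.
  have hcs : ∑ l, ‖p l x‖ ≤ √(Fintype.card ι) * ‖x‖ := by
    refine abs_le_of_sq_le_sq' ?_ (by positivity) |>.2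
    rw [mul_pow, Real.sq_sqrt (Nat.cast_nonneg _), ← sum_norm_sq_apply hadj hmul hsum x]
    exact sq_sum_le_card_mul_sum_sq
  calc ‖(∑ k, ∑ l, c k l • (p k * a * p l)) x‖
      ≤ ∑ l, ‖∑ k, c k l • p k (a (p l x))‖ := hx ▸ norm_sum_le _ _
    _ ≤ ∑ l, b * (‖a‖ * ‖p l x‖) := Finset.sum_le_sum fun l _ =>
        (norm_sum_smul_apply_le hadj hmul hsum hb (fun k => hc k l) _).trans
          (mul_le_mul_of_nonneg_left (a.le_opNorm _) hb)
    _ = b * ‖a‖ * ∑ l, ‖p l x‖ := by rw [Finset.mul_sum]; simp only [mul_assoc]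
    _ ≤ b * ‖a‖ * (√(Fintype.card ι) * ‖x‖) := by gcongr
    _ = √(Fintype.card ι) * b * ‖a‖ * ‖x‖ := by ring

end Resolution

/-- If `A` is the commutator of `H` with a differentiable bounded family `F`, then perturbing `κ H`
by `A` changes the propagator only by a term of order `1 / κ`. -/
theorem norm_propagator_sub_le {H A F F' : ℝ → 𝓗 →L[ℂ] 𝓗} {κ a d f : ℝ} (hκ : 0 < κ)
    (hH : ContinuousOn H (Icc 0 T)) (hHsa : ∀ t ∈ Icc 0 T, IsSelfAdjoint (H t))
    (hA : ContinuousOn A (Icc 0 T)) (hAsa : ∀ t ∈ Icc 0 T, IsSelfAdjoint (A t))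
    (hF : ∀ t ∈ Icc 0 T, HasDerivWithinAt F (F' t) (Icc 0 T) t)
    (hcomm : ∀ t ∈ Icc 0 T, H t * F t - F t * H t = A t)
    (ha : ∀ t ∈ Icc 0 T, ‖A t‖ ≤ a) (hf : ∀ t ∈ Icc 0 T, ‖F t‖ ≤ f)
    (hd : ∀ t ∈ Icc 0 T, ‖F' t + Complex.I • (A t * F t - F t * A t)‖ ≤ d)
    {t : ℝ} (ht : t ∈ Icc 0 T) :
    ‖propagator (fun s => κ • H s) t - propagator (fun s => κ • H s + A s) t‖ ≤
      κ⁻¹ * (2 * f + T * (f * a + d)) := by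
  have hT : 0 ≤ T := ht.1.trans ht.2
  have h0 : (0 : ℝ) ∈ Icc 0 T := left_mem_Icc.2 hT
  have hf0 : 0 ≤ f := (norm_nonneg _).trans (hf t ht)
  have ha0 : 0 ≤ a := (norm_nonneg _).trans (ha t ht)
  have hd0 : 0 ≤ d := (norm_nonneg _).trans (hd t ht)
  have hκH : ContinuousOn (fun s => κ • H s) (Icc 0 T) := hH.const_smul κ
  have hκHsa : ∀ s ∈ Icc 0 T, IsSelfAdjoint (κ • H s) := fun s hs =>
    (IsSelfAdjoint.all κ).smul (hHsa s hs)
  have hκHA : ContinuousOn (fun s => κ • H s + A s) (Icc 0 T) := hκH.add hA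
  have hκHAsa : ∀ s ∈ Icc 0 T, IsSelfAdjoint (κ • H s + A s) := fun s hs =>
    (hκHsa s hs).add (hAsa s hs)
  set U := propagator (fun s => κ • H s) with hU
  set V := propagator (fun s => κ • H s + A s) with hV
  have hUn : ∀ s ∈ Icc 0 T, ‖U s‖ ≤ 1 := fun s hs => norm_propagator_le_one hκH hκHsa hs
  have hVn : ∀ s ∈ Icc 0 T, ‖V s‖ ≤ 1 := fun s hs => norm_propagator_le_one hκHA hκHAsa hs
  have hsand : ∀ s ∈ Icc 0 T, ∀ X : 𝓗 →L[ℂ] 𝓗, ‖star (V s) * X * U s‖ ≤ ‖X‖ := by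
    intro s hs X
    have h1 := hUn s hs
    have h2 := hVn s hs
    calc ‖star (V s) * X * U s‖ ≤ ‖star (V s)‖ * ‖X‖ * ‖U s‖ :=
          (norm_mul_le _ _).trans (by gcongr; exact norm_mul_le _ _)
      _ ≤ 1 * ‖X‖ * 1 := by rw [norm_star]; gcongr
      _ = ‖X‖ := by ring
  -- `Φ = V†U - κ⁻¹ V†FU` varies slowly: the contribution of `A` itself cancels.
  have hΦ : ∀ s ∈ Icc 0 T, HasDerivWithinAt
      (fun s => star (V s) * U s - κ⁻¹ • (star (V s) * F s * U s))
      (-(κ⁻¹ • (star (V s) * (Complex.I • (F s * A s) +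
        (F' s + Complex.I • (A s * F s - F s * A s))) * U s))) (Icc 0 T) s := by
    intro s hs
    have hUd := hasDerivWithinAt_propagator hκH hs
    have hVd := hasDerivWithinAt_star_propagator hκHA hκHAsa hs
    refine ((hVd.mul hUd).sub (((hVd.mul (hF s hs)).mul hUd).const_smul κ⁻¹)).congr_deriv ?_
    rw [← hU, ← hV]
    -- Moving `H` past `F` produces the `A` term that cancels the derivative of `V†U`.
    have hHF : H s * (F s * U s) = A s * U s + F s * (H s * U s) := by
      rw [← mul_assoc, ← mul_assoc, ← add_mul, ← hcomm s hs, sub_add_cancel]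
    simp only [mul_add, add_mul, mul_sub, sub_mul, smul_mul_assoc, mul_smul_comm, smul_add,
      smul_sub, neg_smul, mul_neg, mul_assoc, Pi.mul_apply, hHF, smul_neg, smul_comm κ⁻¹ Complex.I,
      smul_smul κ⁻¹ κ, inv_mul_cancel₀ hκ.ne', one_smul, smul_comm Complex.I κ]
    abel
  have hΦle := (convex_Icc 0 T).norm_image_sub_le_of_norm_hasDerivWithin_le hΦ
    (C := κ⁻¹ * (f * a + d)) (fun s hs => ?_) h0 ht
  · have hV0 : V 0 = 1 := propagator_zero _
    have hU0 : U 0 = 1 := propagator_zero _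
    have hdecomp : U t - V t = V t * (star (V t) * U t - 1) := by
      rw [mul_sub, ← mul_assoc, propagator_mul_star_self hκHA hκHAsa ht, one_mul, mul_one]
    -- The two boundary terms, at `t` and at `0`, give the `2 * f`.
    have hsplit : star (V t) * U t - 1 =
        (star (V t) * U t - κ⁻¹ • (star (V t) * F t * U t) -
          (star (V 0) * U 0 - κ⁻¹ • (star (V 0) * F 0 * U 0))) +
        κ⁻¹ • (star (V t) * F t * U t) - κ⁻¹ • (star (V 0) * F 0 * U 0) := by
      rw [hV0, hU0]
      simp only [star_one, one_mul, mul_one]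
      abel
    have hb : ∀ s ∈ Icc 0 T, ‖κ⁻¹ • (star (V s) * F s * U s)‖ ≤ κ⁻¹ * f := by
      intro s hs
      rw [norm_smul, Real.norm_eq_abs, abs_of_pos (inv_pos.2 hκ)]
      gcongr
      exact (hsand s hs _).trans (hf s hs)
    have hC : κ⁻¹ * (f * a + d) * ‖t - 0‖ ≤ κ⁻¹ * (f * a + d) * T := by
      rw [sub_zero, Real.norm_eq_abs, abs_of_nonneg ht.1]
      have := hκ.le
      gcongr
      exact ht.2
    calc ‖U t - V t‖ ≤ ‖V t‖ * ‖star (V t) * U t - 1‖ := by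
          rw [hdecomp]; exact norm_mul_le _ _
      _ ≤ 1 * ‖star (V t) * U t - 1‖ := by gcongr; exact hVn t ht
      _ ≤ κ⁻¹ * (f * a + d) * T + κ⁻¹ * f + κ⁻¹ * f := by
          rw [one_mul, hsplit]
          refine (norm_sub_le _ _).trans (add_le_add ((norm_add_le _ _).trans
            (add_le_add (hΦle.trans hC) (hb t ht))) (hb 0 h0))
      _ = κ⁻¹ * (2 * f + T * (f * a + d)) := by ring
  · rw [norm_neg, norm_smul, Real.norm_eq_abs, abs_of_pos (inv_pos.2 hκ)]
    gcongr
    refine (hsand s hs _).trans ((norm_add_le _ _).trans (add_le_add ?_ (hd s hs)))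
    rw [norm_smul, Complex.norm_I, one_mul]
    exact (norm_mul_le _ _).trans (mul_le_mul (hf s hs) (ha s hs) (norm_nonneg _) hf0)

/-! ### Gap and slope bounds for the weights. -/

section Spectral

variable {m : ℕ}

theorem isCompact_setOf_ne {f : Fin m → Fin m → ℝ → ℝ}
    (hf : ∀ k l, ContinuousOn (f k l) (Icc 0 T)) :
    IsCompact {x | ∃ k l : Fin m, k ≠ l ∧ ∃ t ∈ Icc 0 T, x = f k l t} := by
  have h : {x | ∃ k l : Fin m, k ≠ l ∧ ∃ t ∈ Icc 0 T, x = f k l t} =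
      ⋃ k, ⋃ l, ⋃ _ : k ≠ l, f k l '' Icc 0 T := by
    ext x
    simp [eq_comm]
  rw [h]
  exact isCompact_iUnion fun k => isCompact_iUnion fun l => isCompact_iUnion fun _ =>
    isCompact_Icc.image_of_continuousOn (hf k l)

variable {E : Fin m → ℝ → ℝ}

theorem isCompact_gaps (hE : ∀ l, ContinuousOn (E l) (Icc 0 T)) :
    IsCompact {x | ∃ k l : Fin m, k ≠ l ∧ ∃ t ∈ Icc 0 T, x = |E k t - E l t|} :=
  isCompact_setOf_ne fun k l => ((hE k).sub (hE l)).abs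

theorem minGap_le (hE : ∀ l, ContinuousOn (E l) (Icc 0 T)) {k l : Fin m} (hkl : k ≠ l) {t : ℝ}
    (ht : t ∈ Icc 0 T) : minGap T E ≤ |E k t - E l t| :=
  csInf_le (isCompact_gaps hE).bddBelow ⟨k, l, hkl, t, ht, rfl⟩

theorem minGap_nonneg : 0 ≤ minGap T E := by
  refine Real.sInf_nonneg ?_
  rintro _ ⟨k, l, -, t, -, rfl⟩
  exact abs_nonneg _

theorem minGap_pos (hT : 0 ≤ T) (hE : ∀ l, ContinuousOn (E l) (Icc 0 T))
    (hgap : ∀ t ∈ Icc 0 T, ∀ k l, k ≠ l → 0 < |E k t - E l t|) {k l : Fin m} (hkl : k ≠ l) :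
    0 < minGap T E := by
  obtain ⟨k', l', hkl', t, ht, h⟩ := (isCompact_gaps hE).sInf_mem
    ⟨_, k, l, hkl, 0, left_mem_Icc.2 hT, rfl⟩
  exact (hgap t ht k' l' hkl').trans_eq h.symm

theorem le_maxSlope (hT : 0 < T) (hE : ∀ l, ContDiffOn ℝ 1 (E l) (Icc 0 T)) {k l : Fin m}
    (hkl : k ≠ l) {t : ℝ} (ht : t ∈ Icc 0 T) :
    |derivWithin (fun s => E k s - E l s) (Icc 0 T) t| ≤ maxSlope T E :=
  le_csSup (isCompact_setOf_ne fun k l => (((hE k).sub (hE l)).continuousOn_derivWithin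
    (uniqueDiffOn_Icc hT) le_rfl).abs).bddAbove ⟨k, l, hkl, t, ht, rfl⟩

theorem maxSlope_nonneg : 0 ≤ maxSlope T E := by
  refine Real.sSup_nonneg ?_
  rintro _ ⟨k, l, -, t, -, rfl⟩
  exact abs_nonneg _

/-- Diagonal weights are `0⁻¹ = 0`, so `k = l` needs only `0 ≤ minGap T E`, which survives `m ≤ 1`,
where `minGap` is `sInf ∅ = 0`. -/
theorem abs_inv_sub_le (hT : 0 ≤ T) (hE : ∀ l, ContinuousOn (E l) (Icc 0 T))
    (hgap : ∀ t ∈ Icc 0 T, ∀ k l, k ≠ l → 0 < |E k t - E l t|) {t : ℝ} (ht : t ∈ Icc 0 T)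
    (k l : Fin m) : |(E k t - E l t)⁻¹| ≤ (minGap T E)⁻¹ := by
  rcases eq_or_ne k l with rfl | hkl
  · simpa using minGap_nonneg
  · rw [abs_inv]
    exact inv_anti₀ (minGap_pos hT hE hgap hkl) (minGap_le hE hkl ht)

theorem hasDerivWithinAt_inv_sub (hE : ∀ l, DifferentiableOn ℝ (E l) (Icc 0 T))
    (hgap : ∀ t ∈ Icc 0 T, ∀ k l, k ≠ l → 0 < |E k t - E l t|) {t : ℝ} (ht : t ∈ Icc 0 T)
    (k l : Fin m) :
    HasDerivWithinAt (fun s => (E k s - E l s)⁻¹)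
      (-derivWithin (fun s => E k s - E l s) (Icc 0 T) t * ((E k t - E l t)⁻¹) ^ 2)
      (Icc 0 T) t := by
  rcases eq_or_ne k l with rfl | hkl
  · simpa using hasDerivWithinAt_const t (Icc 0 T) (0 : ℝ)
  · have h := ((hE k t ht).sub (hE l t ht)).hasDerivWithinAt.inv (abs_pos.1 (hgap t ht k l hkl))
    exact h.congr_deriv (by rw [inv_pow, div_eq_mul_inv]; rfl)

theorem abs_deriv_inv_sub_le (hT : 0 < T) (hE : ∀ l, ContDiffOn ℝ 1 (E l) (Icc 0 T))
    (hgap : ∀ t ∈ Icc 0 T, ∀ k l, k ≠ l → 0 < |E k t - E l t|) {t : ℝ} (ht : t ∈ Icc 0 T)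
    (k l : Fin m) :
    |-derivWithin (fun s => E k s - E l s) (Icc 0 T) t * ((E k t - E l t)⁻¹) ^ 2| ≤
      maxSlope T E * ((minGap T E)⁻¹) ^ 2 := by
  rcases eq_or_ne k l with rfl | hkl
  · have := maxSlope_nonneg (T := T) (E := E)
    simp only [sub_self, inv_zero]
    norm_num
    positivity
  · rw [abs_mul, abs_neg, abs_pow]
    have h1 := le_maxSlope hT hE hkl ht
    have h2 := abs_inv_sub_le hT.le (fun l => (hE l).continuousOn) hgap ht k l
    have := maxSlope_nonneg (T := T) (E := E)
    gcongr

end Spectral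

/-! ### The connection and parallel transport of the projections. -/

section Connection

variable {m : ℕ} {P : Fin m → ℝ → 𝓗 →L[ℂ] 𝓗}

theorem contDiffOn_connection (hT : 0 < T) (hP : ∀ l, ContDiffOn ℝ 2 (P l) (Icc 0 T)) :
    ContDiffOn ℝ 1 (connection T P) (Icc 0 T) := by
  have h1 : ∀ l, ContDiffOn ℝ 1 (derivWithin (P l) (Icc 0 T)) (Icc 0 T) := fun l =>
    (hP l).derivWithin (uniqueDiffOn_Icc hT) (by norm_num)
  have h2 : ∀ l, ContDiffOn ℝ 1 (P l) (Icc 0 T) := fun l => (hP l).of_le (by norm_num)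
  exact ContDiffOn.sum fun l _ =>
    (((h1 l).mul (h2 l)).sub ((h2 l).mul (h1 l))).const_smul (Complex.I / 2)

theorem isSelfAdjoint_connection (hPadj : ∀ t ∈ Icc 0 T, ∀ l, IsSelfAdjoint (P l t)) {t : ℝ}
    (ht : t ∈ Icc 0 T) : IsSelfAdjoint (connection T P t) := by
  have hd : ∀ l, star (derivWithin (P l) (Icc 0 T) t) = derivWithin (P l) (Icc 0 T) t := by
    intro l
    rw [← derivWithin.star]
    exact derivWithin_congr (fun s hs => (hPadj s hs l).star_eq) (hPadj t ht l).star_eq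
  rw [IsSelfAdjoint, connection, star_sum]
  refine Finset.sum_congr rfl fun l _ => ?_
  rw [star_smul, star_sub, star_mul, star_mul, hd, (hPadj t ht l).star_eq]
  have : star (Complex.I / 2) = -(Complex.I / 2) := by
    simp [neg_div]
  rw [this]
  module

theorem derivWithin_proj_leibniz (hT : 0 < T) (hP : ∀ l, DifferentiableOn ℝ (P l) (Icc 0 T))
    (hPmul : ∀ t ∈ Icc 0 T, ∀ k l, P k t * P l t = if k = l then P l t else 0)
    {t : ℝ} (ht : t ∈ Icc 0 T) (k l : Fin m) :
    derivWithin (P k) (Icc 0 T) t * P l t + P k t * derivWithin (P l) (Icc 0 T) t =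
      if k = l then derivWithin (P l) (Icc 0 T) t else 0 := by
  have hu := uniqueDiffOn_Icc hT t ht
  have h := ((hP k t ht).hasDerivWithinAt.mul (hP l t ht).hasDerivWithinAt).derivWithin hu
  refine h.symm.trans ?_
  rw [derivWithin_congr (f₁ := P k * P l) (f := fun s => if k = l then P l s else 0)
    (fun s hs => hPmul s hs k l) (hPmul t ht k l)]
  split_ifs with hkl
  · rfl
  · simp

theorem connection_eq (hT : 0 < T) (hP : ∀ l, DifferentiableOn ℝ (P l) (Icc 0 T))
    (hPmul : ∀ t ∈ Icc 0 T, ∀ k l, P k t * P l t = if k = l then P l t else 0)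
    (hPsum : ∀ t ∈ Icc 0 T, ∑ l, P l t = 1)
    {t : ℝ} (ht : t ∈ Icc 0 T) :
    connection T P t = Complex.I • ∑ l, derivWithin (P l) (Icc 0 T) t * P l t :=
  sum_commutator_eq (derivWithin_proj_leibniz hT hP hPmul ht)
    (sum_derivWithin_proj hT hP hPsum ht)

/-- The spectral projections are parallel with respect to the connection. -/
theorem derivWithin_proj (hT : 0 < T) (hP : ∀ l, DifferentiableOn ℝ (P l) (Icc 0 T))
    (hPmul : ∀ t ∈ Icc 0 T, ∀ k l, P k t * P l t = if k = l then P l t else 0)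
    (hPsum : ∀ t ∈ Icc 0 T, ∑ l, P l t = 1)
    {t : ℝ} (ht : t ∈ Icc 0 T) (l : Fin m) :
    derivWithin (P l) (Icc 0 T) t =
      -(Complex.I • (connection T P t * P l t - P l t * connection T P t)) := by
  rw [connection_eq hT hP hPmul hPsum ht, smul_mul_assoc, mul_smul_comm,
    sum_mul_proj (hPmul t ht), proj_mul_sum (hPmul t ht) (hPsum t ht)
      (derivWithin_proj_leibniz hT hP hPmul ht), ← smul_sub, smul_smul, Complex.I_mul_I]
  simp

theorem proj_mul_connection_mul_proj (hT : 0 < T) (hP : ∀ l, DifferentiableOn ℝ (P l) (Icc 0 T))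
    (hPmul : ∀ t ∈ Icc 0 T, ∀ k l, P k t * P l t = if k = l then P l t else 0)
    (hPsum : ∀ t ∈ Icc 0 T, ∑ l, P l t = 1)
    {t : ℝ} (ht : t ∈ Icc 0 T) (l : Fin m) :
    P l t * connection T P t * P l t = 0 := by
  rw [connection_eq hT hP hPmul hPsum ht, mul_smul_comm,
    proj_mul_sum (hPmul t ht) (hPsum t ht) (derivWithin_proj_leibniz hT hP hPmul ht),
    smul_mul_assoc, sub_mul, mul_assoc, hPmul t ht l l]
  simp

/-- The block sums `∑ c k l • P k * A * P l` have covariant derivative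
`∑ c' k l • P k * A * P l + c k l • P k * A' * P l`. -/
theorem hasDerivWithinAt_sum_blocks (hT : 0 < T) (hP : ∀ l, DifferentiableOn ℝ (P l) (Icc 0 T))
    (hPmul : ∀ t ∈ Icc 0 T, ∀ k l, P k t * P l t = if k = l then P l t else 0)
    (hPsum : ∀ t ∈ Icc 0 T, ∑ l, P l t = 1)
    {c : Fin m → Fin m → ℝ → ℝ} {c' : Fin m → Fin m → ℝ}
    {t : ℝ} (ht : t ∈ Icc 0 T)
    (hA : DifferentiableOn ℝ (connection T P) (Icc 0 T))
    (hc : ∀ k l, HasDerivWithinAt (c k l) (c' k l) (Icc 0 T) t) :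
    HasDerivWithinAt (fun s => ∑ k, ∑ l, c k l s • (P k s * connection T P s * P l s))
      (∑ k, ∑ l, c' k l • (P k t * connection T P t * P l t) +
        ∑ k, ∑ l, c k l t • (P k t * derivWithin (connection T P) (Icc 0 T) t * P l t) -
        Complex.I • (connection T P t * (∑ k, ∑ l, c k l t • (P k t * connection T P t * P l t)) -
          (∑ k, ∑ l, c k l t • (P k t * connection T P t * P l t)) * connection T P t))
      (Icc 0 T) t := by
  have hPd : ∀ l, HasDerivWithinAt (P l)
      (-(Complex.I • (connection T P t * P l t - P l t * connection T P t))) (Icc 0 T) t := by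
    intro l
    rw [← derivWithin_proj hT hP hPmul hPsum ht l]
    exact (hP l t ht).hasDerivWithinAt
  refine (HasDerivWithinAt.fun_sum fun k _ => HasDerivWithinAt.fun_sum fun l _ =>
    (hc k l).smul (((hPd k).mul (hA t ht).hasDerivWithinAt).mul (hPd l))).congr_deriv ?_
  simp only [Finset.mul_sum, Finset.sum_mul, ← Finset.sum_sub_distrib, ← Finset.sum_add_distrib,
    Finset.smul_sum]
  -- In each block the inner terms `P k * A * A * P l` from the two projections cancel, leaving
  -- `-i[A, P k * A * P l]`.
  refine Finset.sum_congr rfl fun k _ => Finset.sum_congr rfl fun l _ => ?_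
  simp only [add_mul, mul_sub, sub_mul, smul_mul_assoc, mul_smul_comm, smul_add,
    smul_sub, neg_mul, mul_neg, mul_assoc, Pi.mul_apply, smul_neg, smul_comm Complex.I (c k l t)]
  abel

end Connection

end Adiabatic

open Adiabatic

theorem mainTheorem5
    {𝓗 : Type*} [NormedAddCommGroup 𝓗] [InnerProductSpace ℂ 𝓗] [CompleteSpace 𝓗]
    {m : ℕ} {T : ℝ} (hT : 0 ≤ T)
    (H₀ : ℝ → 𝓗 →L[ℂ] 𝓗) (E : Fin m → ℝ → ℝ) (P : Fin m → ℝ → 𝓗 →L[ℂ] 𝓗)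
    (hH₀ : ∀ t ∈ Set.Icc 0 T, H₀ t = ∑ l, E l t • P l t)
    (hPadj : ∀ t ∈ Set.Icc 0 T, ∀ l, IsSelfAdjoint (P l t))
    (hPmul : ∀ t ∈ Set.Icc 0 T, ∀ k l, P k t * P l t = if k = l then P l t else 0)
    (hPsum : ∀ t ∈ Set.Icc 0 T, ∑ l, P l t = 1)
    (hE : ∀ l, ContDiffOn ℝ 1 (E l) (Set.Icc 0 T))
    (hP : ∀ l, ContDiffOn ℝ 2 (P l) (Set.Icc 0 T))
    (hgap : ∀ t ∈ Set.Icc 0 T, ∀ k l, k ≠ l → 0 < |E k t - E l t|)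
    {κ : ℝ} (hκ : 0 < κ) :
    ∀ t ∈ Set.Icc 0 T,
      ‖Adiabatic.propagator (fun s => κ • H₀ s) t -
          Adiabatic.propagator (fun s => κ • H₀ s + Adiabatic.connection T P s) t‖ ≤
        √(m : ℝ) / (κ * Adiabatic.minGap T E) *
          (1 + T * Adiabatic.supNorm T (Adiabatic.connection T P)) *
          ((2 + Adiabatic.maxSlope T E / Adiabatic.minGap T E * T) *
              Adiabatic.supNorm T (Adiabatic.connection T P) +
            T * Adiabatic.supNorm T
              (derivWithin (Adiabatic.connection T P) (Set.Icc 0 T))) := by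
  intro t ht
  have hη : 0 ≤ minGap T E := minGap_nonneg
  have hη' : 0 ≤ maxSlope T E := maxSlope_nonneg
  have ha0 : 0 ≤ supNorm T (connection T P) := supNorm_nonneg _
  have hb0 : 0 ≤ supNorm T (derivWithin (connection T P) (Icc 0 T)) := supNorm_nonneg _
  -- On a one-point interval derivatives within it are not unique, so `T = 0` is separate; both
  -- propagators are then `1`.
  rcases hT.eq_or_lt with rfl | hT
  · obtain rfl : t = 0 := le_antisymm ht.2 ht.1
    rw [propagator_zero, propagator_zero, sub_self, norm_zero]
    positivity
  have hAC := contDiffOn_connection hT hP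
  have hA := hAC.continuousOn
  have hA' := hAC.continuousOn_derivWithin (uniqueDiffOn_Icc hT) le_rfl
  have hPd : ∀ l, DifferentiableOn ℝ (P l) (Icc 0 T) := fun l =>
    (hP l).differentiableOn (by norm_num)
  have hEc : ∀ l, ContinuousOn (E l) (Icc 0 T) := fun l => (hE l).continuousOn
  have hH : ContinuousOn H₀ (Icc 0 T) :=
    (continuousOn_finsetSum Finset.univ fun l _ =>
      (hEc l).smul (hP l).continuousOn).congr hH₀
  have hHsa : ∀ s ∈ Icc 0 T, IsSelfAdjoint (H₀ s) := fun s hs => by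
    rw [hH₀ s hs]
    exact isSelfAdjoint_sum _ fun l _ => (IsSelfAdjoint.all (E l s)).smul (hPadj s hs l)
  have hblock : ∀ s ∈ Icc 0 T, ∀ (c : Fin m → Fin m → ℝ) (b : ℝ), 0 ≤ b →
      (∀ k l, |c k l| ≤ b) → ∀ (X : 𝓗 →L[ℂ] 𝓗) (x : ℝ), ‖X‖ ≤ x →
      ‖∑ k, ∑ l, c k l • (P k s * X * P l s)‖ ≤ √m * b * x := by
    intro s hs c b hb hc X x hX
    refine (norm_sum_blocks_le (hPadj s hs) (hPmul s hs) (hPsum s hs) hb hc X).trans ?_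
    rw [Fintype.card_fin]
    gcongr
  have hinv : ∀ s ∈ Icc 0 T, ∀ k l, |(E k s - E l s)⁻¹| ≤ (minGap T E)⁻¹ := fun s hs =>
    abs_inv_sub_le hT.le hEc hgap hs
  have key := norm_propagator_sub_le (H := H₀) (A := connection T P)
    (a := supNorm T (connection T P))
    (f := √m * (minGap T E)⁻¹ * supNorm T (connection T P))
    (d := √m * (maxSlope T E * (minGap T E)⁻¹ ^ 2) * supNorm T (connection T P) +
      √m * (minGap T E)⁻¹ * supNorm T (derivWithin (connection T P) (Icc 0 T)))
    hκ hH hHsa hA (fun s hs => isSelfAdjoint_connection hPadj hs)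
    (fun s hs => hasDerivWithinAt_sum_blocks hT hPd hPmul hPsum hs
      (hAC.differentiableOn (by norm_num))
      (hasDerivWithinAt_inv_sub (fun l => (hE l).differentiableOn (by norm_num)) hgap hs))
    (fun s hs => by
      rw [hH₀ s hs]
      exact commutator_sum_blocks (hPmul s hs) (hPsum s hs)
        (fun k l hkl => sub_ne_zero.1 (abs_pos.1 (hgap s hs k l hkl)))
        (proj_mul_connection_mul_proj hT hPd hPmul hPsum hs))
    (fun s hs => le_supNorm hA hs)
    (fun s hs => hblock s hs _ _ (inv_nonneg.2 hη) (hinv s hs) _ _ (le_supNorm hA hs))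
    (fun s hs => by
      -- The commutator with `A` in the derivative of `F` cancels the covariant correction.
      rw [sub_add_cancel]
      exact (norm_add_le _ _).trans (add_le_add
        (hblock s hs _ _ (by positivity) (abs_deriv_inv_sub_le hT hE hgap hs) _ _
          (le_supNorm hA hs))
        (hblock s hs _ _ (inv_nonneg.2 hη) (hinv s hs) _ _ (le_supNorm hA' hs))))
    ht
  refine key.trans ?_
  set a := supNorm T (connection T P)
  set b := supNorm T (derivWithin (connection T P) (Icc 0 T))
  set g := (minGap T E)⁻¹ with hg
  have hg0 : 0 ≤ g := inv_nonneg.2 hη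
  -- Exactly the claimed bound minus the one in `key`: the product form is slightly weaker.
  have hdiff : 0 ≤ κ⁻¹ * √m * g * (T * a * (a + maxSlope T E * g * T * a + T * b)) := by
    positivity
  rw [div_eq_mul_inv, mul_inv, div_eq_mul_inv, ← hg]
  linarith

end
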